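/- A Herglotz--Pick (HP) function is an analytic map $F:\mathbb{C}^+\to\overline{\mathbb{C}^+}=\mathbb{C}^+\cup\mathbb{R}$ on the open upper half-plane. It has a unique spectral representation $$F(z)=b+az+\int_{\mathbb{R}}\Big(\frac{1}{u-z}-\frac{u}{u^2+1}\Big)\,\mu(du),\qquad a\ge 0,\ b\in\mathbb{R},\ \int\frac{\mu(du)}{u^2+1}<\infty ,$$ where $\mu$, a non-negative Borel measure on $\mathbb{R}$, is its spectral measure. The space of HP functions carries the topology of the pairs $(\mu,F(i))$: vague convergence of $\mu$ (against continuous compactly supported functions) together with convergence of $F(i)$; equivalently, pointwise convergence on $\mathbb{C}^+$. A random HP function is given by a Borel probability measure on this space, and $F_n\to F$ in distribution means weak convergence of these laws. Boundary values $F(x+i0)=\lim_{\eta\downarrow0}F(x+i\eta)$, $x\in\mathbb{R}$, are taken in the Riemann sphere $\overline{\mathbb{C}}=\mathbb{C}\cup\{\infty\}$; they exist for Lebesgue-almost every $x$, and we set $F(x+i0):=\infty$ where the limit does not exist. With $\frac{1}{\infty+i}:=0$, the mean modulus of $*$-continuity of a random HP function $F$ at $x$ is $$\kappa_F(x,\delta)=\mathbb{E}\left|\frac{1}{F(x+\delta+i0)+i}-\frac{1}{F(x+i0)+i}\right|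 .$$ **Theorem.** Let $(F_n)$ be a sequence of random HP functions that converges in distribution to a random HP function $F$. Let $\kappa(x,\delta)\in[0,\infty]$, and let $x\in\mathbb{R}$ be such that $\kappa_{F_n}(x,\delta)\le\kappa(x,\delta)$ for every $n$ and $\kappa_F(x,\delta)\le\kappa(x,\delta)$, for Lebesgue-almost every $\delta\in\mathbb{R}$, and $$\lim_{\delta\to0}\kappa(x,\delta)=0 .$$ Then the random variables $F_n(x+i0)$ converge in distribution, as random variables with values in the Riemann sphere $\overline{\mathbb{C}}$, to $F(x+i0)$. -/

import Mathlib

open MeasureTheory Filter Topology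
open scoped ENNReal

noncomputable section

/-- A Herglotz–Pick function, i.e. an analytic map from the open upper half-plane into its closure,
given by the data `a ≥ 0`, `b ∈ ℝ`, `μ` of its (unique) spectral representation
`F(z) = b + a z + ∫ (1/(u - z) - u/(u² + 1)) μ(du)`. -/
@[ext]
structure HPFunction where
  a : ℝ
  b : ℝ
  /-- the spectral measure -/
  μ : Measure ℝ
  a_nonneg : 0 ≤ a
  integrable : Integrable (fun u : ℝ => (u ^ 2 + 1)⁻¹) μ

namespace HPFunction

/-- The value `F(z)`, to be used for `z` in the open upper half-plane. -/
def eval (F : HPFunction) (z : ℂ) : ℂ :=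
  F.b + F.a * z + ∫ u : ℝ, (1 / ((u : ℂ) - z) - (u : ℂ) / ((u : ℂ) ^ 2 + 1)) ∂F.μ

/-- The pair `(μ, F(i))`; the spectral measure `μ` is recorded through its integrals against
compactly supported continuous functions. -/
def pair (F : HPFunction) : (CompactlySupportedContinuousMap ℝ ℝ → ℝ) × ℂ :=
  (fun f => ∫ u, f u ∂F.μ, F.eval Complex.I)

/-- The topology of the pairs `(μ, F(i))`: vague convergence of the spectral measure `μ` together
with convergence of the value `F(i)`. -/
instance : TopologicalSpace HPFunction := TopologicalSpace.induced pair inferInstance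

instance : MeasurableSpace HPFunction := borel HPFunction

instance : BorelSpace HPFunction := ⟨rfl⟩

end HPFunction

/-- The Riemann sphere `OnePoint ℂ` carries its Borel `σ`-algebra. -/
instance : MeasurableSpace (OnePoint ℂ) := borel (OnePoint ℂ)

instance : BorelSpace (OnePoint ℂ) := ⟨rfl⟩

/-- `w = F(x + i0)`: the limit of `F(x + iη)` as `η ↓ 0`, taken in the Riemann sphere, is `w`. -/
def HPFunction.HasBoundaryValue (F : HPFunction) (x : ℝ) (w : OnePoint ℂ) : Prop :=
  Tendsto (fun η : ℝ => ((F.eval (x + η * Complex.I) : ℂ) : OnePoint ℂ)) (𝓝[>] 0) (𝓝 w)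

open Classical in
/-- The boundary value `F(x + i0)` in the Riemann sphere. By convention it is `∞` at the
(Lebesgue-null set of) `x` at which the limit does not exist. -/
def HPFunction.boundaryValue (F : HPFunction) (x : ℝ) : OnePoint ℂ :=
  if h : ∃ w, F.HasBoundaryValue x w then h.choose else OnePoint.infty

/-- The function `w ↦ 1/(w + i)` on the Riemann sphere, with value `0` at `∞`
(it is only used on the closure of the upper half-plane). -/
def starCoord (w : OnePoint ℂ) : ℂ :=
  w.elim 0 (fun z => 1 / (z + Complex.I))

/-- The (mean) modulus of `*`-continuity at `x` of the random HP function with law `P`: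
`E |1/(F(x+δ+i0)+i) - 1/(F(x+i0)+i)|`. -/
def starModulus (P : ProbabilityMeasure HPFunction) (x δ : ℝ) : ℝ≥0∞ :=
  ∫⁻ F, ‖starCoord (F.boundaryValue (x + δ)) - starCoord (F.boundaryValue x)‖ₑ
    ∂(P : Measure HPFunction)

end

/-! In the coordinate `w ↦ 1/(w + i)` an HP function `F` becomes `G = 1/(F + i)`, holomorphic on the
upper half-plane and bounded by 1, and `κ_F` is a mean increment of its boundary values `G*`. The
Poisson formula says `G(x + iη) = E G*(x + ηU)` with `U` standard Cauchy (`integral_verticalLimit`).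
By Tonelli, the mean of `|G(x + iη) - G*(x)|` under a law is at most the Cauchy average of the
modulus at `ηU` (`lintegral_starFun_sub_le`). The modulus never exceeds 2, is dominated by `κ`, and
`ηU` concentrates at 0 as `η → 0`; so one height `η` serves all the `F_n` and `F` at once
(`exists_height`). At a fixed height there is no boundary problem: `F ↦ F(z)` is continuous
(`continuous_eval`), so expectations of bounded continuous functions of `G_n(x + iη)` converge. A
three-term estimate with bounded Lipschitz test functions gives convergence in law of `G_n*(x)`, and
the continuous map `w ↦ 1/w - i`, sending 0 to ∞, carries it to the sphere. The Poisson formula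
needs Fatou's theorem. The primitive of `G` has Lipschitz, hence a.e. differentiable, boundary
values; after integration by parts the Poisson integral becomes an integral of difference quotients
of that primitive, and dominated convergence gives the vertical limit wherever it is differentiable.
-/

/-- The closed upper half-plane. -/
def closedUpperHalfPlane : Set ℂ := {z | 0 ≤ z.im}

/-- The open upper half-plane. -/
def openUpperHalfPlane : Set ℂ := {z | 0 < z.im}

lemma isOpen_openUpperHalfPlane : IsOpen openUpperHalfPlane :=
  isOpen_lt continuous_const Complex.continuous_im

lemma isClosed_closedUpperHalfPlane : IsClosed closedUpperHalfPlane :=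
  isClosed_le continuous_const Complex.continuous_im

/-! ### Cauchy's theorem and the Poisson formula on horizontal lines -/

lemma integrable_ofReal_of_decay {f : ℂ → ℂ} {C : ℝ}
    (hf : DifferentiableOn ℂ f closedUpperHalfPlane)
    (hC : ∀ z : ℂ, 0 ≤ z.im → ‖f z‖ ≤ C * (1 + ‖z‖ ^ 2)⁻¹) :
    Integrable (fun t : ℝ => f t) := by
  have hc : Continuous (fun t : ℝ => f t) :=
    hf.continuousOn.comp_continuous Complex.continuous_ofReal
      (fun t => by simp [closedUpperHalfPlane])
  refine (integrable_inv_one_add_sq.const_mul C).mono' hc.aestronglyMeasurable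
    (Eventually.of_forall fun t => ?_)
  simpa using hC t (by simp)

/-- A holomorphic function on the closed upper half-plane with quadratic decay integrates to zero
along the real line. -/
lemma integral_ofReal_eq_zero_of_decay {f : ℂ → ℂ} {C : ℝ}
    (hf : DifferentiableOn ℂ f closedUpperHalfPlane)
    (hC : ∀ z : ℂ, 0 ≤ z.im → ‖f z‖ ≤ C * (1 + ‖z‖ ^ 2)⁻¹) :
    ∫ t : ℝ, f t = 0 := by
  have hC0 : 0 ≤ C := by simpa using (norm_nonneg _).trans (hC 0 (by simp))
  have h1 := intervalIntegral_tendsto_integral (integrable_ofReal_of_decay hf hC)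
    tendsto_neg_atTop_atBot tendsto_id
  refine tendsto_nhds_unique h1 ?_
  have hdecay : ∀ (z : ℂ) (R : ℝ), 0 ≤ z.im → 0 < R → R ≤ ‖z‖ → ‖f z‖ ≤ C * (R ^ 2)⁻¹ := by
    intro z R hz hR hRz
    refine (hC z hz).trans (mul_le_mul_of_nonneg_left ?_ hC0)
    refine inv_anti₀ (by positivity) ?_
    nlinarith
  have hlim : Tendsto (fun R : ℝ => 4 * C * R⁻¹) atTop (𝓝 0) := by
    simpa using tendsto_inv_atTop_zero.const_mul (4 * C)
  refine squeeze_zero_norm' ?_ hlim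
  filter_upwards [eventually_gt_atTop 0] with R hR
  -- On the rectangle `[-R, R] × [0, R]` the three sides off the real axis have total length `4R`,
  -- and `f` is at most `C/R²` there.
  have hrect := Complex.integral_boundary_rect_eq_zero_of_differentiableOn f (-R : ℝ)
    ((R : ℝ) + R * Complex.I) (hf.mono (fun z hz => by
      have := hz.2
      simp [Set.uIcc_of_le hR.le] at this
      exact this.1))
  simp only [Complex.ofReal_re, Complex.ofReal_im, Complex.add_re, Complex.add_im, Complex.mul_re,
    Complex.mul_im, Complex.I_re, Complex.I_im, mul_zero, mul_one, zero_add, add_zero,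
    sub_zero, Complex.ofReal_zero, zero_mul] at hrect
  have e1 : ‖∫ t in (-R)..R, f (t + R * Complex.I)‖ ≤ C * (R ^ 2)⁻¹ * |R - -R| := by
    refine intervalIntegral.norm_integral_le_of_norm_le_const fun t _ => hdecay _ R ?_ hR ?_
    · simpa using hR.le
    · exact le_trans (by simp [le_abs_self]) (Complex.abs_im_le_norm _)
  have e2 : ‖∫ y in (0 : ℝ)..R, f (R + y * Complex.I)‖ ≤ C * (R ^ 2)⁻¹ * |R - 0| := by
    refine intervalIntegral.norm_integral_le_of_norm_le_const fun t ht => hdecay _ R ?_ hR ?_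
    · rw [Set.uIoc_of_le hR.le] at ht; simpa using ht.1.le
    · exact le_trans (by simp [le_abs_self]) (Complex.abs_re_le_norm _)
  have e3 : ‖∫ y in (0 : ℝ)..R, f ((-R : ℝ) + y * Complex.I)‖ ≤ C * (R ^ 2)⁻¹ * |R - 0| := by
    refine intervalIntegral.norm_integral_le_of_norm_le_const fun t ht => hdecay _ R ?_ hR ?_
    · rw [Set.uIoc_of_le hR.le] at ht; simpa using ht.1.le
    · exact le_trans (by simp [le_abs_self]) (Complex.abs_re_le_norm _)
  have key : ∫ t in (-R)..R, f t = (∫ t in (-R)..R, f (t + R * Complex.I))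
      - Complex.I • (∫ y in (0 : ℝ)..R, f (R + y * Complex.I))
      + Complex.I • ∫ y in (0 : ℝ)..R, f ((-R : ℝ) + y * Complex.I) := by
    linear_combination hrect
  simp only [id]
  rw [key]
  refine (norm_add_le _ _).trans ((add_le_add (norm_sub_le _ _) le_rfl).trans ?_)
  rw [norm_smul, norm_smul, Complex.norm_I, one_mul, one_mul]
  rw [sub_neg_eq_add, abs_of_pos (by linarith)] at e1
  rw [sub_zero, abs_of_pos hR] at e2 e3
  have : C * (R ^ 2)⁻¹ * (R + R) + C * (R ^ 2)⁻¹ * R + C * (R ^ 2)⁻¹ * R = 4 * C * R⁻¹ := by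
    field_simp; ring
  linarith

/-- The Poisson formula at `i` for bounded holomorphic functions on the closed half-plane. -/
lemma poisson_I {g : ℂ → ℂ} (hg : DifferentiableOn ℂ g closedUpperHalfPlane)
    (hb : ∀ z : ℂ, 0 ≤ z.im → ‖g z‖ ≤ 1) :
    ∫ t : ℝ, ((1 + t ^ 2)⁻¹ : ℝ) • g t = Real.pi • g Complex.I := by
  -- This is `(g(z) - g(i))/(z² + 1)` with its singularity at `i` removed; its vanishing integral
  -- over the real line is the Poisson formula.
  set f : ℂ → ℂ := fun z => dslope g Complex.I z / (z + Complex.I) with hfdef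
  have hne : ∀ z : ℂ, 0 ≤ z.im → z + Complex.I ≠ 0 := by
    intro z hz h
    have := congrArg Complex.im h
    simp at this
    linarith
  have hnhds : closedUpperHalfPlane ∈ 𝓝 Complex.I :=
    mem_of_superset (isOpen_openUpperHalfPlane.mem_nhds (by simp [openUpperHalfPlane]))
      (fun z (hz : 0 < z.im) => hz.le)
  have hf : DifferentiableOn ℂ f closedUpperHalfPlane :=
    ((Complex.differentiableOn_dslope hnhds).2 hg).div (by fun_prop) hne
  have hcpt : IsCompact (closedUpperHalfPlane ∩ Metric.closedBall 0 2) :=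
    (isCompact_closedBall _ _).inter_left isClosed_closedUpperHalfPlane
  obtain ⟨C, hC⟩ := hcpt.exists_bound_of_continuousOn (hf.continuousOn.mono Set.inter_subset_left)
  -- For `‖z‖ ≤ 2` use compactness and `1 + ‖z‖² ≤ 5`; beyond, `‖f z‖ (‖z‖² - 1) ≤ 2` with `‖z‖² ≥
  -- 4`.
  have hbound : ∀ z : ℂ, 0 ≤ z.im → ‖f z‖ ≤ (max (5 * C) 4) * (1 + ‖z‖ ^ 2)⁻¹ := by
    intro z hz
    rw [← div_eq_mul_inv, le_div_iff₀ (by positivity)]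
    rcases le_or_gt ‖z‖ 2 with h2 | h2
    · have := hC z ⟨hz, by simpa using h2⟩
      have h5 : 1 + ‖z‖ ^ 2 ≤ 5 := by nlinarith [norm_nonneg z]
      refine le_trans ?_ (le_max_left _ _)
      nlinarith [norm_nonneg (f z), norm_nonneg z]
    · refine le_trans ?_ (le_max_right _ _)
      have hzI : z ≠ Complex.I := by rintro rfl; norm_num at h2
      have hfz : f z * (z ^ 2 + 1) = g z - g Complex.I := by
        have h1 : z - Complex.I ≠ 0 := sub_ne_zero.2 hzI
        have h2 := hne z hz
        have h3 : z ^ 2 + 1 = (z - Complex.I) * (z + Complex.I) := by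
          linear_combination Complex.I_sq
        rw [hfdef, h3]
        simp only [dslope_of_ne _ hzI, slope_def_field]
        field_simp
      have h4 : ‖f z‖ * ‖z ^ 2 + 1‖ ≤ 2 := by
        rw [← norm_mul, hfz]
        refine (norm_sub_le _ _).trans ?_
        linarith [hb z hz, hb Complex.I (by simp)]
      have h5 : ‖z‖ ^ 2 - 1 ≤ ‖z ^ 2 + 1‖ := by
        have := norm_sub_norm_le (z ^ 2) (-1)
        simpa using this
      have h6 := mul_le_mul_of_nonneg_left h5 (norm_nonneg (f z))
      have h7 : 4 ≤ ‖z‖ ^ 2 := by nlinarith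
      have h8 := mul_le_mul_of_nonneg_left h7 (norm_nonneg (f z))
      nlinarith
  have h0 := integral_ofReal_eq_zero_of_decay hf hbound
  have hgint : Integrable (fun t : ℝ => ((1 + t ^ 2)⁻¹ : ℝ) • g t) := by
    have hc : Continuous (fun t : ℝ => g t) :=
      hg.continuousOn.comp_continuous Complex.continuous_ofReal
        (fun t => by simp [closedUpperHalfPlane])
    exact integrable_inv_one_add_sq.smul_bdd 1 hc.aestronglyMeasurable
      (Eventually.of_forall fun t => hb t (by simp))
  have heq : ∀ t : ℝ, f t = ((1 + t ^ 2)⁻¹ : ℝ) • g t - ((1 + t ^ 2)⁻¹ : ℝ) • g Complex.I := by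
    intro t
    have htI : (t : ℂ) ≠ Complex.I := by
      intro h; have := congrArg Complex.im h; simp at this
    have h1 : (t : ℂ) - Complex.I ≠ 0 := sub_ne_zero.2 htI
    have h2 := hne t (by simp)
    have h3 : (1 : ℂ) + (t : ℂ) ^ 2 = (t - Complex.I) * (t + Complex.I) := by
      linear_combination Complex.I_sq
    rw [hfdef]
    simp only [dslope_of_ne _ htI, slope_def_field, Complex.real_smul]
    push_cast
    rw [h3]
    field_simp
  simp_rw [heq] at h0
  rw [integral_sub hgint (integrable_inv_one_add_sq.smul_const _), integral_smul_const,
    integral_univ_inv_one_add_sq, sub_eq_zero] at h0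
  exact h0

/-- The Poisson formula for bounded holomorphic functions on the half-plane, for the values on a
horizontal line. -/
lemma poisson_horizontal {G : ℂ → ℂ} (hG : DifferentiableOn ℂ G openUpperHalfPlane)
    (hb : ∀ z : ℂ, 0 < z.im → ‖G z‖ ≤ 1) (x : ℝ) {η ε : ℝ} (hη : 0 < η) (hε : 0 < ε) :
    ∫ t : ℝ, ((1 + t ^ 2)⁻¹ : ℝ) • G ((x + η * t : ℝ) + ε * Complex.I)
      = Real.pi • G (x + (η + ε : ℝ) * Complex.I) := by
  have hm : ∀ z : ℂ, 0 ≤ z.im → 0 < ((x : ℂ) + η * z + ε * Complex.I).im := by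
    intro z hz
    simp
    positivity
  have := poisson_I (g := fun z => G (x + η * z + ε * Complex.I))
    (hG.comp (by fun_prop) (fun z hz => hm z hz)) (fun z hz => hb _ (hm z hz))
  have e : (x : ℂ) + (η + ε : ℝ) * Complex.I = x + η * Complex.I + ε * Complex.I := by
    push_cast; ring
  rw [e, ← this]
  congr with t
  push_cast
  rfl

/-! ### Fatou's theorem through the boundary values of a primitive -/

/-- The primitive of `G` along the horizontal line at height `ε`. -/
noncomputable def horizontalPrimitive (G : ℂ → ℂ) (ε t : ℝ) : ℂ :=
  ∫ s in (0 : ℝ)..t, G (s + ε * Complex.I)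

/-- The boundary values on the real line of a primitive of `G`. -/
noncomputable def boundaryPrimitive (G : ℂ → ℂ) (t : ℝ) : ℂ :=
  horizontalPrimitive G 1 t +
    Complex.I • ∫ y in (0 : ℝ)..1, (G (y * Complex.I) - G (t + y * Complex.I))

section

variable {G : ℂ → ℂ}

lemma continuous_horizontal (hG : DifferentiableOn ℂ G openUpperHalfPlane) {ε : ℝ} (hε : 0 < ε) :
    Continuous (fun s : ℝ => G (s + ε * Complex.I)) :=
  hG.continuousOn.comp_continuous (by fun_prop) (fun t => by simpa [openUpperHalfPlane] using hε)

lemma continuousOn_vertical (hG : DifferentiableOn ℂ G openUpperHalfPlane) (t : ℝ) :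
    ContinuousOn (fun y : ℝ => G (t + y * Complex.I)) (Set.Ioi 0) :=
  hG.continuousOn.comp (by fun_prop) (fun y hy => by simpa [openUpperHalfPlane] using hy)

lemma hasDerivAt_horizontalPrimitive (hG : DifferentiableOn ℂ G openUpperHalfPlane) {ε : ℝ}
    (hε : 0 < ε) (t : ℝ) :
    HasDerivAt (horizontalPrimitive G ε) (G (t + ε * Complex.I)) t :=
  intervalIntegral.integral_hasDerivAt_right
    ((continuous_horizontal hG hε).intervalIntegrable _ _)
    ((continuous_horizontal hG hε).stronglyMeasurableAtFilter _ _)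
    (continuous_horizontal hG hε).continuousAt

lemma lipschitzWith_horizontalPrimitive (hG : DifferentiableOn ℂ G openUpperHalfPlane)
    (hb : ∀ z : ℂ, 0 < z.im → ‖G z‖ ≤ 1) {ε : ℝ} (hε : 0 < ε) :
    LipschitzWith 1 (horizontalPrimitive G ε) := by
  refine lipschitzWith_of_nnnorm_deriv_le
    (fun t => (hasDerivAt_horizontalPrimitive hG hε t).differentiableAt) (fun t => ?_)
  rw [(hasDerivAt_horizontalPrimitive hG hε t).deriv, ← NNReal.coe_le_coe]
  simpa using hb (t + ε * Complex.I) (by simpa using hε)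

lemma intervalIntegrable_vertical (hG : DifferentiableOn ℂ G openUpperHalfPlane)
    (hb : ∀ z : ℂ, 0 < z.im → ‖G z‖ ≤ 1) (t : ℝ) {a b : ℝ} (ha : 0 ≤ a) (hab : a ≤ b) :
    IntervalIntegrable (fun y : ℝ => G (t + y * Complex.I)) volume a b := by
  have hs : Set.Ioc a b ⊆ Set.Ioi 0 := fun y hy => lt_of_le_of_lt ha hy.1
  rw [intervalIntegrable_iff_integrableOn_Ioc_of_le hab]
  refine IntegrableOn.of_bound (C := 1) measure_Ioc_lt_top
    (((continuousOn_vertical hG t).mono hs).aestronglyMeasurable measurableSet_Ioc) ?_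
  filter_upwards [ae_restrict_mem measurableSet_Ioc] with y hy
  exact hb _ (by simpa using hs hy)

/-- Cauchy's theorem on the rectangle between heights `ε` and 1 leaves only the two vertical
segments from height 0 to `ε`, on which the integrands are bounded by 1. -/
lemma norm_boundaryPrimitive_sub_le (hG : DifferentiableOn ℂ G openUpperHalfPlane)
    (hb : ∀ z : ℂ, 0 < z.im → ‖G z‖ ≤ 1) {ε : ℝ} (hε : 0 < ε) (hε1 : ε ≤ 1) (t : ℝ) :
    ‖boundaryPrimitive G t - horizontalPrimitive G ε t‖ ≤ 2 * ε := by
  have hrect := Complex.integral_boundary_rect_eq_zero_of_differentiableOn G (ε * Complex.I)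
    ((t : ℝ) + Complex.I) (hG.mono (fun z hz => by
      have h2 := hz.2
      simp [Set.uIcc_of_le hε1] at h2
      exact hε.trans_le h2.1))
  simp only [Complex.ofReal_re, Complex.ofReal_im, Complex.add_re, Complex.add_im, Complex.mul_re,
    Complex.mul_im, Complex.I_re, Complex.I_im, mul_zero, mul_one, zero_add, add_zero,
    sub_zero, Complex.ofReal_zero] at hrect
  have hint : ∀ (s : ℝ) {a b : ℝ}, 0 ≤ a → a ≤ b →
      IntervalIntegrable (fun y : ℝ => G (s + y * Complex.I)) volume a b :=
    fun s a b ha hab => intervalIntegrable_vertical hG hb s ha hab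
  have hint0 : ∀ {a b : ℝ}, 0 ≤ a → a ≤ b →
      IntervalIntegrable (fun y : ℝ => G (y * Complex.I)) volume a b := by
    intro a b ha hab
    simpa using hint 0 ha hab
  have hsplit := intervalIntegral.integral_add_adjacent_intervals
    ((hint0 le_rfl hε.le).sub (hint t le_rfl hε.le)) ((hint0 hε.le hε1).sub (hint t hε.le hε1))
  have hsub := intervalIntegral.integral_sub (hint0 hε.le hε1) (hint t hε.le hε1)
  have key : boundaryPrimitive G t - horizontalPrimitive G ε t =
      Complex.I • ∫ y in (0 : ℝ)..ε, (G (y * Complex.I) - G (t + y * Complex.I)) := by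
    unfold boundaryPrimitive horizontalPrimitive
    rw [← hsplit, hsub]
    simp only [smul_eq_mul, Complex.ofReal_one] at hrect ⊢
    linear_combination -hrect
  rw [key, norm_smul, Complex.norm_I, one_mul]
  have := intervalIntegral.norm_integral_le_of_norm_le_const (a := 0) (b := ε) (C := 2)
    (f := fun y : ℝ => G (y * Complex.I) - G (t + y * Complex.I)) (fun y hy => by
      rw [Set.uIoc_of_le hε.le] at hy
      refine (norm_sub_le _ _).trans ?_
      linarith [hb (y * Complex.I) (by simpa using hy.1),
        hb (t + y * Complex.I) (by simpa using hy.1)])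
  rwa [sub_zero, abs_of_pos hε] at this

lemma tendsto_horizontalPrimitive (hG : DifferentiableOn ℂ G openUpperHalfPlane)
    (hb : ∀ z : ℂ, 0 < z.im → ‖G z‖ ≤ 1) (t : ℝ) :
    Tendsto (fun ε => horizontalPrimitive G ε t) (𝓝[>] 0) (𝓝 (boundaryPrimitive G t)) := by
  rw [tendsto_iff_norm_sub_tendsto_zero]
  have h : Tendsto (fun ε : ℝ => 2 * ε) (𝓝[>] 0) (𝓝 0) :=
    tendsto_nhdsWithin_of_tendsto_nhds (Continuous.tendsto' (by fun_prop) _ _ (by simp))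
  refine squeeze_zero' (Eventually.of_forall fun _ => norm_nonneg _) ?_ h
  filter_upwards [Ioc_mem_nhdsGT (zero_lt_one' ℝ)] with ε hε
  rw [norm_sub_rev]
  exact norm_boundaryPrimitive_sub_le hG hb hε.1 hε.2 t

lemma lipschitzWith_boundaryPrimitive (hG : DifferentiableOn ℂ G openUpperHalfPlane)
    (hb : ∀ z : ℂ, 0 < z.im → ‖G z‖ ≤ 1) : LipschitzWith 1 (boundaryPrimitive G) := by
  refine LipschitzWith.of_dist_le_mul fun s t => ?_
  refine le_of_tendsto
    ((tendsto_horizontalPrimitive hG hb s).dist (tendsto_horizontalPrimitive hG hb t)) ?_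
  filter_upwards [self_mem_nhdsWithin] with ε hε
  exact (lipschitzWith_horizontalPrimitive hG hb hε).dist_le_mul s t

/-- The difference quotient of `h` at `x`, weighted by minus the derivative of `1 / (1 + u ^ 2)`. -/
noncomputable def weightedQuotient (h : ℝ → ℂ) (x η u : ℝ) : ℂ :=
  (2 * u * ((1 + u ^ 2)⁻¹) ^ 2 : ℝ) • (η⁻¹ • (h (x + η * u) - h x))

lemma norm_quotient_le {h : ℝ → ℂ} (hh : LipschitzWith 1 h) (x u : ℝ) {η : ℝ} (hη : 0 < η) :
    ‖η⁻¹ • (h (x + η * u) - h x)‖ ≤ |u| := by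
  have := hh.dist_le_mul (x + η * u) x
  rw [dist_eq_norm, dist_eq_norm, Real.norm_eq_abs, add_sub_cancel_left, abs_mul,
    abs_of_pos hη] at this
  rw [norm_smul, Real.norm_eq_abs, abs_inv, abs_of_pos hη, inv_mul_le_iff₀ hη]
  simpa using this

/-- The bound depends neither on `h` nor on `η`, so it dominates both limits taken below: `ε → 0` in
the primitive and `η → 0` in the quotient. -/
lemma norm_weightedQuotient_le {h : ℝ → ℂ} (hh : LipschitzWith 1 h) (x u : ℝ) {η : ℝ}
    (hη : 0 < η) : ‖weightedQuotient h x η u‖ ≤ 2 * (1 + u ^ 2)⁻¹ := by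
  unfold weightedQuotient
  rw [norm_smul]
  refine (mul_le_mul_of_nonneg_left (norm_quotient_le hh x u hη) (norm_nonneg _)).trans ?_
  rw [Real.norm_eq_abs, abs_mul, abs_mul, abs_two, abs_of_nonneg (a := ((1 + u ^ 2)⁻¹) ^ 2)
    (by positivity)]
  have h1 : 2 * |u| * ((1 + u ^ 2)⁻¹) ^ 2 * |u| = 2 * (u ^ 2 * (1 + u ^ 2)⁻¹) * (1 + u ^ 2)⁻¹ := by
    rw [← sq_abs u]; ring
  rw [h1]
  have h2 : u ^ 2 * (1 + u ^ 2)⁻¹ ≤ 1 := by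
    rw [← div_eq_mul_inv, div_le_one (by positivity)]; linarith
  have h3 : 0 ≤ (1 + u ^ 2)⁻¹ := by positivity
  nlinarith

lemma continuous_weightedQuotient {h : ℝ → ℂ} (hh : LipschitzWith 1 h) (x η : ℝ) :
    Continuous (weightedQuotient h x η) := by
  have := hh.continuous
  have hne : ∀ u : ℝ, 1 + u ^ 2 ≠ 0 := fun u => by positivity
  unfold weightedQuotient
  fun_prop (disch := assumption)

lemma integrable_weightedQuotient {h : ℝ → ℂ} (hh : LipschitzWith 1 h) (x : ℝ) {η : ℝ}
    (hη : 0 < η) : Integrable (weightedQuotient h x η) :=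
  (integrable_inv_one_add_sq.const_mul 2).mono'
    (continuous_weightedQuotient hh x η).aestronglyMeasurable
    (Eventually.of_forall fun u => norm_weightedQuotient_le hh x u hη)

/-- Integrating the Poisson formula by parts moves the derivative from the primitive to the kernel.
Only the primitive is left, and it still makes sense at height 0. -/
lemma integral_weightedQuotient_horizontalPrimitive
    (hG : DifferentiableOn ℂ G openUpperHalfPlane)
    (hb : ∀ z : ℂ, 0 < z.im → ‖G z‖ ≤ 1) (x : ℝ) {η ε : ℝ} (hη : 0 < η) (hε : 0 < ε) :
    ∫ u, weightedQuotient (horizontalPrimitive G ε) x η u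
      = Real.pi • G (x + (η + ε : ℝ) * Complex.I) := by
  rw [← poisson_horizontal hG hb x hη hε]
  have hlip := lipschitzWith_horizontalPrimitive hG hb hε
  set h := horizontalPrimitive G ε
  set k : ℝ → ℂ := fun u => ((1 + u ^ 2)⁻¹ : ℝ)
  set k' : ℝ → ℂ := fun u => (-(2 * u * ((1 + u ^ 2)⁻¹) ^ 2) : ℝ)
  set v : ℝ → ℂ := fun u => η⁻¹ • (h (x + η * u) - h x)
  set v' : ℝ → ℂ := fun u => G ((x + η * u : ℝ) + ε * Complex.I)
  have hk : ∀ u, HasDerivAt k (k' u) u := by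
    intro u
    have h1 : HasDerivAt (fun u : ℝ => (1 + u ^ 2)⁻¹) (-(2 * u * ((1 + u ^ 2)⁻¹) ^ 2)) u := by
      have := ((hasDerivAt_pow 2 u).const_add 1).inv (by positivity : 1 + u ^ 2 ≠ 0)
      refine this.congr_deriv ?_
      norm_num
      field_simp
    exact h1.ofReal_comp
  have hv : ∀ u, HasDerivAt v (v' u) u := by
    intro u
    have h1 := hasDerivAt_horizontalPrimitive hG hε (x + η * u)
    have h2 : HasDerivAt (fun u : ℝ => x + η * u) η u := by
      simpa using ((hasDerivAt_id u).const_mul η).const_add x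
    have h3 := ((h1.scomp u h2).sub_const (h x)).const_smul η⁻¹
    rw [smul_smul, inv_mul_cancel₀ hη.ne', one_smul] at h3
    exact h3
  have hkv' : Integrable (k * v') := by
    have hc : Continuous v' := (continuous_horizontal hG hε).comp (by fun_prop)
    have := integrable_inv_one_add_sq.smul_bdd 1 hc.aestronglyMeasurable
      (Eventually.of_forall fun t => hb _ (by simpa using hε))
    exact this.congr (Eventually.of_forall fun u => by simp [k])
  have hk'v : k' * v = fun u => - weightedQuotient h x η u := by
    ext u
    simp [k', v, weightedQuotient]
  have hbd : ∀ u, ‖(k * v) u‖ ≤ |u|⁻¹ := by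
    intro u
    rcases eq_or_ne u 0 with rfl | hu
    · simp [k, v]
    have hu' : 0 < |u| := abs_pos.2 hu
    have h1 : ‖(k * v) u‖ ≤ (1 + u ^ 2)⁻¹ * |u| := by
      rw [Pi.mul_apply, norm_mul]
      refine mul_le_mul (le_of_eq ?_) (norm_quotient_le hlip x u hη) (norm_nonneg _) (by positivity)
      simp only [k, Complex.norm_real, Real.norm_eq_abs]
      exact abs_of_nonneg (by positivity)
    refine h1.trans ?_
    rw [← sq_abs, inv_mul_le_iff₀ (by positivity)]
    field_simp
    linarith
  have hlim : ∀ l : Filter ℝ, Tendsto (fun u => |u|) l atTop → Tendsto (k * v) l (𝓝 0) :=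
    fun l hl => squeeze_zero_norm hbd (tendsto_inv_atTop_zero.comp hl)
  have hparts := integral_mul_deriv_eq_deriv_mul (fun u _ => hk u) (fun u _ => hv u) hkv'
    (by rw [hk'v]; exact (integrable_weightedQuotient hlip x hη).neg)
    (hlim _ tendsto_abs_atBot_atTop) (hlim _ tendsto_abs_atTop_atTop)
  have hk'v' : ∀ u, k' u * v u = - weightedQuotient h x η u := fun u => congrFun hk'v u
  simp_rw [hk'v', integral_neg] at hparts
  simp only [Complex.real_smul]
  rw [hparts]
  ring

lemma integral_weightedQuotient_boundaryPrimitive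
    (hG : DifferentiableOn ℂ G openUpperHalfPlane)
    (hb : ∀ z : ℂ, 0 < z.im → ‖G z‖ ≤ 1) (x : ℝ) {η : ℝ} (hη : 0 < η) :
    ∫ u, weightedQuotient (boundaryPrimitive G) x η u = Real.pi • G (x + η * Complex.I) := by
  have h1 : Tendsto (fun ε : ℝ => ∫ u, weightedQuotient (horizontalPrimitive G ε) x η u) (𝓝[>] 0)
      (𝓝 (∫ u, weightedQuotient (boundaryPrimitive G) x η u)) := by
    refine tendsto_integral_filter_of_dominated_convergence (fun u => 2 * (1 + u ^ 2)⁻¹) ?_ ?_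
      (integrable_inv_one_add_sq.const_mul 2) ?_
    · filter_upwards [self_mem_nhdsWithin] with ε hε
      exact (continuous_weightedQuotient
        (lipschitzWith_horizontalPrimitive hG hb hε) x η).aestronglyMeasurable
    · filter_upwards [self_mem_nhdsWithin] with ε hε
      exact Eventually.of_forall fun u =>
        norm_weightedQuotient_le (lipschitzWith_horizontalPrimitive hG hb hε) x u hη
    · refine Eventually.of_forall fun u => ?_
      exact (((tendsto_horizontalPrimitive hG hb _).sub
        (tendsto_horizontalPrimitive hG hb _)).const_smul _).const_smul _
  have h2 : Tendsto (fun ε : ℝ => Real.pi • G (x + (η + ε : ℝ) * Complex.I)) (𝓝[>] 0)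
      (𝓝 (Real.pi • G (x + η * Complex.I))) := by
    have hc : ContinuousAt (fun ε : ℝ => G (x + (η + ε : ℝ) * Complex.I)) 0 := by
      refine ContinuousAt.comp (f := fun ε : ℝ => (x : ℂ) + (η + ε : ℝ) * Complex.I) (g := G) ?_
        (by fun_prop)
      exact hG.continuousOn.continuousAt
        (isOpen_openUpperHalfPlane.mem_nhds (by simpa [openUpperHalfPlane] using hη))
    have := (hc.tendsto.const_smul Real.pi).mono_left (nhdsWithin_le_nhds (s := Set.Ioi 0))
    simpa using this
  refine tendsto_nhds_unique (h1.congr' ?_) h2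
  filter_upwards [self_mem_nhdsWithin] with ε hε
  exact integral_weightedQuotient_horizontalPrimitive hG hb x hη hε

/-- **Fatou's theorem** for bounded holomorphic functions on the upper half-plane. -/
theorem ae_exists_tendsto_vertical (hG : DifferentiableOn ℂ G openUpperHalfPlane)
    (hb : ∀ z : ℂ, 0 < z.im → ‖G z‖ ≤ 1) :
    ∀ᵐ x : ℝ, ∃ c, Tendsto (fun η : ℝ => G (x + η * Complex.I)) (𝓝[>] 0) (𝓝 c) := by
  have hlip := lipschitzWith_boundaryPrimitive hG hb
  filter_upwards [hlip.ae_differentiableAt_real] with x hx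
  set h := boundaryPrimitive G
  have h1 : Tendsto (fun η : ℝ => ∫ u, weightedQuotient h x η u) (𝓝[>] 0)
      (𝓝 (∫ u : ℝ, (2 * u * ((1 + u ^ 2)⁻¹) ^ 2 : ℝ) • (u • deriv h x))) := by
    refine tendsto_integral_filter_of_dominated_convergence (fun u => 2 * (1 + u ^ 2)⁻¹) ?_ ?_
      (integrable_inv_one_add_sq.const_mul 2) ?_
    · exact Eventually.of_forall fun η => (continuous_weightedQuotient hlip x η).aestronglyMeasurable
    · filter_upwards [self_mem_nhdsWithin] with η hη
      exact Eventually.of_forall fun u => norm_weightedQuotient_le hlip x u hη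
    · refine Eventually.of_forall fun u => Tendsto.const_smul ?_ _
      have hd : HasDerivAt (fun η : ℝ => h (x + η * u)) (u • deriv h x) 0 := by
        have h2 : HasDerivAt (fun η : ℝ => x + η * u) u 0 := by
          simpa using ((hasDerivAt_id (0 : ℝ)).mul_const u).const_add x
        have h3 : HasDerivAt h (deriv h x) (x + 0 * u) := by simpa using hx.hasDerivAt
        exact h3.scomp 0 h2
      have := hd.tendsto_slope_zero_right
      simpa using this
  refine ⟨_, (h1.const_smul Real.pi⁻¹).congr' ?_⟩
  filter_upwards [self_mem_nhdsWithin] with η hη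
  rw [integral_weightedQuotient_boundaryPrimitive hG hb x hη, smul_smul,
    inv_mul_cancel₀ Real.pi_ne_zero, one_smul]

end

/-! ### Measurability of one-sided limits -/

open Classical in
/-- The limit of `φ` at `0` from the right, with the value `0` if there is none. -/
noncomputable def rightLimit (φ : ℝ → ℂ) : ℂ :=
  if h : ∃ c, Tendsto φ (𝓝[>] 0) (𝓝 c) then h.choose else 0

lemma rightLimit_eq {φ : ℝ → ℂ} {c : ℂ} (h : Tendsto φ (𝓝[>] 0) (𝓝 c)) : rightLimit φ = c := by
  have h' : ∃ c, Tendsto φ (𝓝[>] 0) (𝓝 c) := ⟨c, h⟩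
  rw [rightLimit, dif_pos h']
  exact tendsto_nhds_unique h'.choose_spec h

lemma rightLimit_of_not_exists {φ : ℝ → ℂ} (h : ¬ ∃ c, Tendsto φ (𝓝[>] 0) (𝓝 c)) :
    rightLimit φ = 0 := dif_neg h

lemma norm_rightLimit_le {φ : ℝ → ℂ} {C : ℝ} (hC : 0 ≤ C) (h : ∀ η, 0 < η → ‖φ η‖ ≤ C) :
    ‖rightLimit φ‖ ≤ C := by
  by_cases h' : ∃ c, Tendsto φ (𝓝[>] 0) (𝓝 c)
  · obtain ⟨c, hc⟩ := h'
    rw [rightLimit_eq hc]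
    refine le_of_tendsto hc.norm ?_
    filter_upwards [self_mem_nhdsWithin] with η hη using h η hη
  · rwa [rightLimit_of_not_exists h', norm_zero]

/-- Rational numbers tending to `0` from the right. -/
def ratNhdsGT : Filter ℚ := comap ((↑) : ℚ → ℝ) (𝓝[>] 0)

instance : ratNhdsGT.NeBot := by
  refine comap_neBot fun t ht => ?_
  obtain ⟨u, hu, hut⟩ := mem_nhdsGT_iff_exists_Ioo_subset.1 ht
  obtain ⟨q, hq⟩ := exists_rat_btwn (show (0 : ℝ) < u from hu)
  exact ⟨q, hut hq⟩

instance : ratNhdsGT.IsCountablyGenerated := by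
  unfold ratNhdsGT; infer_instance

/-- If `φ` leaves a closed ball at some `η`, continuity makes it do so on an open set around `η`,
which contains a rational. Limits thus reduce to a countable family of functions. -/
lemma tendsto_ratNhdsGT_iff {φ : ℝ → ℂ} (hφ : ContinuousOn φ (Set.Ioi 0)) {c : ℂ} :
    Tendsto (fun q : ℚ => φ q) ratNhdsGT (𝓝 c) ↔ Tendsto φ (𝓝[>] 0) (𝓝 c) := by
  refine ⟨fun h => ?_, fun h => h.comp tendsto_comap⟩
  rw [Metric.nhds_basis_closedBall.tendsto_right_iff] at h ⊢
  intro ε hε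
  obtain ⟨s, hs, hsub⟩ := h ε hε
  obtain ⟨u, hu, hut⟩ := mem_nhdsGT_iff_exists_Ioo_subset.1 hs
  filter_upwards [Ioo_mem_nhdsGT (show (0 : ℝ) < u from hu)] with η hη
  by_contra hcon
  have hca : ContinuousAt φ η := hφ.continuousAt (Ioi_mem_nhds hη.1)
  have hev : ∀ᶠ y in 𝓝 η, φ y ∈ (Metric.closedBall c ε)ᶜ :=
    hca.eventually_mem (Metric.isClosed_closedBall.isOpen_compl.mem_nhds hcon)
  have hev' := hev.and (Ioo_mem_nhds hη.1 hη.2)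
  obtain ⟨_, ⟨q, rfl⟩, hy1, hy2⟩ := Rat.denseRange_cast.inter_nhds_nonempty hev'
  exact hy1 (hsub (hut hy2))

lemma stronglyMeasurable_rightLimit {X : Type*} [MeasurableSpace X] {Φ : ℝ → X → ℂ}
    (hm : ∀ η, 0 < η → StronglyMeasurable (Φ η))
    (hc : ∀ x, ContinuousOn (fun η => Φ η x) (Set.Ioi 0)) :
    StronglyMeasurable (fun x => rightLimit (fun η => Φ η x)) := by
  classical
  -- Nothing is assumed about `Φ` at nonpositive arguments, and the filter ignores them.
  set Ψ : ℚ → X → ℂ := fun q => if 0 < (q : ℝ) then Φ q else 0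
  have hΨ : ∀ q, StronglyMeasurable (Ψ q) := by
    intro q
    by_cases hq : 0 < (q : ℝ)
    · simpa only [Ψ, if_pos hq] using hm q hq
    · simpa only [Ψ, if_neg hq] using stronglyMeasurable_zero
  have hiff : ∀ x c, Tendsto (fun q => Ψ q x) ratNhdsGT (𝓝 c) ↔
      Tendsto (fun η => Φ η x) (𝓝[>] 0) (𝓝 c) := by
    intro x c
    rw [← tendsto_ratNhdsGT_iff (hc x)]
    refine tendsto_congr' ?_
    have : ∀ᶠ q : ℚ in ratNhdsGT, (q : ℝ) ∈ Set.Ioi 0 := tendsto_comap self_mem_nhdsWithin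
    filter_upwards [this] with q hq
    simp only [Ψ, if_pos (show 0 < (q : ℝ) from hq)]
  have heq : (fun x => rightLimit (fun η => Φ η x)) =
      fun x => if ∃ c, Tendsto (fun q => Ψ q x) ratNhdsGT (𝓝 c) then
        limUnder ratNhdsGT (fun q => Ψ q x) else 0 := by
    ext x
    by_cases h : ∃ c, Tendsto (fun q => Ψ q x) ratNhdsGT (𝓝 c)
    · obtain ⟨c, hc'⟩ := h
      rw [if_pos ⟨c, hc'⟩, hc'.limUnder_eq, rightLimit_eq ((hiff x c).1 hc')]
    · rw [if_neg h]
      simp only [hiff] at h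
      exact rightLimit_of_not_exists h
  rw [heq]
  exact StronglyMeasurable.ite (StronglyMeasurable.measurableSet_exists_tendsto hΨ)
    (StronglyMeasurable.limUnder hΨ) stronglyMeasurable_const

/-! ### The Poisson formula in terms of boundary values -/

/-- The standard Cauchy distribution, i.e. the Poisson kernel at `i`. -/
noncomputable def stdCauchy : Measure ℝ := ProbabilityTheory.cauchyMeasure 0 1

instance : IsProbabilityMeasure stdCauchy := by unfold stdCauchy; infer_instance

lemma stdCauchy_eq :
    stdCauchy = volume.withDensity (ProbabilityTheory.cauchyPDF 0 1) :=
  ProbabilityTheory.cauchyMeasure_of_scale_ne_zero 0 one_ne_zero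

lemma stdCauchy_absolutelyContinuous : stdCauchy ≪ volume := by
  rw [stdCauchy_eq]; exact withDensity_absolutelyContinuous _ _

lemma integral_stdCauchy (g : ℝ → ℂ) :
    ∫ u, g u ∂stdCauchy = Real.pi⁻¹ • ∫ u : ℝ, ((1 + u ^ 2)⁻¹ : ℝ) • g u := by
  rw [stdCauchy_eq, integral_withDensity_eq_integral_toReal_smul
    (ProbabilityTheory.measurable_cauchyPDF 0 1)
    (Eventually.of_forall fun u => by simp [ProbabilityTheory.cauchyPDF]), ← integral_smul]
  congr with u
  rw [smul_smul]
  congr 2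
  rw [ProbabilityTheory.cauchyPDF_def, ENNReal.toReal_ofReal
    (ProbabilityTheory.cauchyPDF_pos 0 one_ne_zero u).le, ProbabilityTheory.cauchyPDFReal_def]
  simp [add_comm]

/-- Transfers statements valid for Lebesgue-almost every `δ` to `δ = ηu` for Cauchy-almost every
`u`. -/
lemma quasiMeasurePreserving_const_mul {η : ℝ} (hη : 0 < η) :
    Measure.QuasiMeasurePreserving (fun u : ℝ => η * u) stdCauchy volume := by
  refine ⟨by fun_prop, ?_⟩
  refine (stdCauchy_absolutelyContinuous.map (by fun_prop)).trans ?_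
  rw [Real.map_volume_mul_left hη.ne']
  exact Measure.smul_absolutelyContinuous

/-- The limit of `G` at the boundary point `x` along the vertical ray, or `0` if there is none. -/
noncomputable def verticalLimit (G : ℂ → ℂ) (x : ℝ) : ℂ :=
  rightLimit (fun η => G (x + η * Complex.I))

section

variable {G : ℂ → ℂ}

lemma norm_verticalLimit_le (hb : ∀ z : ℂ, 0 < z.im → ‖G z‖ ≤ 1) (x : ℝ) :
    ‖verticalLimit G x‖ ≤ 1 :=
  norm_rightLimit_le zero_le_one fun η hη => hb _ (by simpa using hη)

/-- The Poisson formula for a bounded holomorphic function on the upper half-plane, in terms of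
its boundary values. -/
theorem integral_verticalLimit (hG : DifferentiableOn ℂ G openUpperHalfPlane)
    (hb : ∀ z : ℂ, 0 < z.im → ‖G z‖ ≤ 1) (x : ℝ) {η : ℝ} (hη : 0 < η) :
    Integrable (fun u => verticalLimit G (x + η * u)) stdCauchy ∧
    ∫ u, verticalLimit G (x + η * u) ∂stdCauchy = G (x + η * Complex.I) := by
  have hcont : ∀ ε : ℝ, 0 < ε → Continuous fun u : ℝ => G ((x + η * u : ℝ) + ε * Complex.I) :=
    fun ε hε => (continuous_horizontal hG hε).comp (by fun_prop)
  have hae : ∀ᵐ u ∂stdCauchy, Tendsto (fun ε : ℝ => G ((x + η * u : ℝ) + ε * Complex.I)) (𝓝[>] 0)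
      (𝓝 (verticalLimit G (x + η * u))) := by
    have h0 := (measurePreserving_add_left volume x).quasiMeasurePreserving.ae
      (ae_exists_tendsto_vertical hG hb)
    filter_upwards [(quasiMeasurePreserving_const_mul hη).ae h0] with u ⟨c, hc⟩
    rwa [verticalLimit, rightLimit_eq hc]
  have hlim : Tendsto (fun ε : ℝ => ∫ u, G ((x + η * u : ℝ) + ε * Complex.I) ∂stdCauchy) (𝓝[>] 0)
      (𝓝 (∫ u, verticalLimit G (x + η * u) ∂stdCauchy)) := by
    refine tendsto_integral_filter_of_dominated_convergence (fun _ => 1) ?_ ?_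
      (integrable_const 1) hae
    · filter_upwards [self_mem_nhdsWithin] with ε hε using (hcont ε hε).aestronglyMeasurable
    · filter_upwards [self_mem_nhdsWithin] with ε hε
      exact Eventually.of_forall fun u => hb _ (by simpa using hε)
  refine ⟨?_, ?_⟩
  · refine Integrable.of_bound ?_ 1 (Eventually.of_forall fun u => norm_verticalLimit_le hb _)
    refine aestronglyMeasurable_of_tendsto_ae ratNhdsGT
      (f := fun (q : ℚ) u => if 0 < (q : ℝ) then G ((x + η * u : ℝ) + (q : ℝ) * Complex.I) else 0)
      (fun q => ?_) ?_
    · split_ifs with hq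
      · exact (hcont q hq).aestronglyMeasurable
      · exact aestronglyMeasurable_const
    · filter_upwards [hae] with u hu
      refine (hu.comp tendsto_comap).congr' ?_
      have : ∀ᶠ q : ℚ in ratNhdsGT, (q : ℝ) ∈ Set.Ioi 0 := tendsto_comap self_mem_nhdsWithin
      filter_upwards [this] with q hq
      simp only [Function.comp, if_pos (show 0 < (q : ℝ) from hq)]
  · refine tendsto_nhds_unique hlim ?_
    have hc : ContinuousAt (fun ε : ℝ => G (x + (η + ε : ℝ) * Complex.I)) 0 := by
      refine ContinuousAt.comp (f := fun ε : ℝ => (x : ℂ) + (η + ε : ℝ) * Complex.I) (g := G) ?_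
        (by fun_prop)
      exact hG.continuousOn.continuousAt
        (isOpen_openUpperHalfPlane.mem_nhds (by simpa [openUpperHalfPlane] using hη))
    have hc' := hc.tendsto.mono_left (nhdsWithin_le_nhds (s := Set.Ioi 0))
    simp only [add_zero] at hc'
    refine hc'.congr' ?_
    filter_upwards [self_mem_nhdsWithin] with ε hε
    rw [integral_stdCauchy, poisson_horizontal hG hb x hη hε, smul_smul,
      inv_mul_cancel₀ Real.pi_ne_zero, one_smul]

lemma enorm_sub_verticalLimit_le (hG : DifferentiableOn ℂ G openUpperHalfPlane)
    (hb : ∀ z : ℂ, 0 < z.im → ‖G z‖ ≤ 1) (x : ℝ) {η : ℝ} (hη : 0 < η) (w : ℂ) :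
    ‖G (x + η * Complex.I) - w‖ₑ ≤ ∫⁻ u, ‖verticalLimit G (x + η * u) - w‖ₑ ∂stdCauchy := by
  obtain ⟨hi, he⟩ := integral_verticalLimit hG hb x hη
  have : G (x + η * Complex.I) - w = ∫ u, (verticalLimit G (x + η * u) - w) ∂stdCauchy := by
    rw [integral_sub hi (integrable_const w), he]
    simp
  rw [this]
  exact enorm_integral_le_lintegral_enorm _

end

/-! ### Analyticity of HP functions and continuity of evaluation -/

lemma ofReal_sub_ne_zero {z : ℂ} (hz : 0 < z.im) (u : ℝ) : (u : ℂ) - z ≠ 0 := by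
  intro h
  have := congrArg Complex.im h
  simp at this
  exact hz.ne' this

lemma norm_ofReal_sub_inv_le {z : ℂ} {r : ℝ} (hr : 0 < r) (hz : r ≤ z.im) (u : ℝ) :
    ‖((u : ℂ) - z)⁻¹‖ ≤ r⁻¹ := by
  rw [norm_inv]
  refine inv_anti₀ hr ?_
  refine le_trans ?_ (Complex.abs_im_le_norm _)
  simpa using hz.trans (le_abs_self _)

lemma continuous_ofReal_sub_inv {z : ℂ} (hz : 0 < z.im) :
    Continuous (fun u : ℝ => ((u : ℂ) - z)⁻¹) :=
  Continuous.inv₀ (by fun_prop) (ofReal_sub_ne_zero hz)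

lemma tendsto_ofReal_sub_inv (z : ℂ) :
    Tendsto (fun u : ℝ => ((u : ℂ) - z)⁻¹) (cocompact ℝ) (𝓝 0) := by
  refine Filter.tendsto_inv₀_cobounded.comp ?_
  refine (tendsto_sub_const_cobounded z).comp ?_
  rw [← tendsto_norm_atTop_iff_cobounded]
  simp only [Complex.norm_real]
  exact tendsto_norm_cocompact_atTop

/-- Soft thresholding at level `ε`. -/
def softThreshold (ε y : ℝ) : ℝ := y - max (-ε) (min y ε)

lemma continuous_softThreshold (ε : ℝ) : Continuous (softThreshold ε) := by
  unfold softThreshold; fun_prop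

lemma softThreshold_eq_zero {ε y : ℝ} (h : |y| ≤ ε) : softThreshold ε y = 0 := by
  obtain ⟨h1, h2⟩ := abs_le.1 h
  rw [softThreshold, min_eq_left h2, max_eq_right h1, sub_self]

lemma abs_sub_softThreshold_le {ε : ℝ} (hε : 0 ≤ ε) (y : ℝ) : |y - softThreshold ε y| ≤ ε := by
  rw [softThreshold, sub_sub_cancel, abs_le]
  exact ⟨le_max_left _ _, max_le (by linarith) (min_le_right _ _)⟩

namespace HPFunction

/-- The integral of `ψ` against the finite measure `μ(du) / (u ^ 2 + 1)`. -/
noncomputable def weightedIntegral (F : HPFunction) (ψ : ℝ → ℝ) : ℝ :=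
  ∫ u, (u ^ 2 + 1)⁻¹ * ψ u ∂F.μ

/-- The Cauchy transform of the finite measure `μ(du) / (u ^ 2 + 1)`. -/
noncomputable def cauchyTransform (F : HPFunction) (z : ℂ) : ℂ :=
  ∫ u : ℝ, ((u ^ 2 + 1)⁻¹ : ℝ) • ((u : ℂ) - z)⁻¹ ∂F.μ

lemma integrable_smul {E : Type*} [NormedAddCommGroup E] [NormedSpace ℝ E]
    (F : HPFunction) {ψ : ℝ → E} {C : ℝ} (hψ : Continuous ψ)
    (hC : ∀ u, ‖ψ u‖ ≤ C) : Integrable (fun u => ((u ^ 2 + 1)⁻¹ : ℝ) • ψ u) F.μ := by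
  have hc : Continuous (fun u : ℝ => (u ^ 2 + 1)⁻¹) :=
    Continuous.inv₀ (by fun_prop) (fun u => by positivity)
  refine (F.integrable.mul_const C).mono' (hc.smul hψ).aestronglyMeasurable
    (Eventually.of_forall fun u => ?_)
  rw [norm_smul, Real.norm_eq_abs, abs_of_nonneg (by positivity)]
  exact mul_le_mul_of_nonneg_left (hC u) (by positivity)

/-- Pulling out the integrable weight `1/(u² + 1)` leaves a constant plus a multiple of `1/(u - z)`,
which vanishes at infinity. -/
lemma kernel_eq {z : ℂ} (hz : 0 < z.im) (u : ℝ) :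
    1 / ((u : ℂ) - z) - (u : ℂ) / ((u : ℂ) ^ 2 + 1) =
      ((u ^ 2 + 1)⁻¹ : ℝ) * z + (1 + z ^ 2) * (((u ^ 2 + 1)⁻¹ : ℝ) • ((u : ℂ) - z)⁻¹) := by
  have h1 := ofReal_sub_ne_zero hz u
  have h2 : (u : ℂ) ^ 2 + 1 ≠ 0 := by
    have : (u ^ 2 + 1 : ℝ) ≠ 0 := by positivity
    exact_mod_cast this
  rw [Complex.real_smul]
  push_cast
  field_simp
  ring

lemma integrable_cauchyKernel (F : HPFunction) {z : ℂ} (hz : 0 < z.im) :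
    Integrable (fun u : ℝ => ((u ^ 2 + 1)⁻¹ : ℝ) • ((u : ℂ) - z)⁻¹) F.μ :=
  F.integrable_smul (continuous_ofReal_sub_inv hz) (norm_ofReal_sub_inv_le hz le_rfl)

lemma integrable_kernel (F : HPFunction) {z : ℂ} (hz : 0 < z.im) :
    Integrable (fun u : ℝ => 1 / ((u : ℂ) - z) - (u : ℂ) / ((u : ℂ) ^ 2 + 1)) F.μ := by
  simp_rw [kernel_eq hz]
  exact (F.integrable.ofReal.mul_const z).add ((F.integrable_cauchyKernel hz).const_mul _)

lemma eval_eq_cauchyTransform (F : HPFunction) {z : ℂ} (hz : 0 < z.im) :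
    F.eval z = F.b + (F.a + ∫ u : ℝ, (u ^ 2 + 1)⁻¹ ∂F.μ : ℝ) * z
      + (1 + z ^ 2) * F.cauchyTransform z := by
  unfold eval
  simp_rw [kernel_eq hz]
  have hi : Integrable (fun u : ℝ => (((u ^ 2 + 1)⁻¹ : ℝ) : ℂ) * z) F.μ :=
    F.integrable.ofReal.mul_const z
  rw [integral_add hi ((F.integrable_cauchyKernel hz).const_mul _),
    integral_const_mul, integral_mul_const, integral_complex_ofReal]
  unfold cauchyTransform
  push_cast
  ring

lemma eval_I (F : HPFunction) :
    F.eval Complex.I = F.b + (F.a + ∫ u : ℝ, (u ^ 2 + 1)⁻¹ ∂F.μ : ℝ) * Complex.I := by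
  rw [eval_eq_cauchyTransform F (by simp)]
  simp

/-- Mass of `μ` escaping to infinity can turn into `a`, so `a` alone is not continuous. Here `a` and
the total weighted mass enter only through their sum `Im F(i)`, which is. -/
lemma eval_eq (F : HPFunction) {z : ℂ} (hz : 0 < z.im) :
    F.eval z = (F.eval Complex.I).re + (F.eval Complex.I).im * z
      + (1 + z ^ 2) * F.cauchyTransform z := by
  rw [eval_eq_cauchyTransform F hz, eval_I]
  simp

lemma integral_weight_le (F : HPFunction) :
    ∫ u : ℝ, (u ^ 2 + 1)⁻¹ ∂F.μ ≤ (F.eval Complex.I).im := by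
  rw [eval_I]
  simpa using F.a_nonneg

lemma eval_im_nonneg (F : HPFunction) {z : ℂ} (hz : 0 < z.im) : 0 ≤ (F.eval z).im := by
  have h : 0 ≤ (∫ u : ℝ, (1 / ((u : ℂ) - z) - (u : ℂ) / ((u : ℂ) ^ 2 + 1)) ∂F.μ).im := by
    have := integral_im (F.integrable_kernel hz)
    simp only [RCLike.im_to_complex] at this
    rw [← this]
    refine integral_nonneg fun u => ?_
    have h1 : (u : ℂ) / ((u : ℂ) ^ 2 + 1) = (u / (u ^ 2 + 1) : ℝ) := by push_cast; rfl
    simp only [h1, Complex.sub_im, Complex.ofReal_im, sub_zero, one_div, Complex.inv_im, zero_sub,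
      neg_neg, Pi.zero_apply]
    exact div_nonneg hz.le (Complex.normSq_nonneg _)
  have h2 := mul_nonneg F.a_nonneg hz.le
  unfold eval
  simp
  simp at h
  linarith

lemma differentiableAt_cauchyTransform (F : HPFunction) {z : ℂ} (hz : 0 < z.im) :
    DifferentiableAt ℂ F.cauchyTransform z := by
  have hr : 0 < z.im / 2 := by positivity
  have him : ∀ w ∈ Metric.ball z (z.im / 2), z.im / 2 ≤ w.im := by
    intro w hw
    rw [Metric.mem_ball, dist_eq_norm] at hw
    have := (Complex.abs_im_le_norm (w - z)).trans hw.le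
    rw [Complex.sub_im, abs_le] at this
    linarith
  have := hasDerivAt_integral_of_dominated_loc_of_deriv_le (μ := F.μ) (𝕜 := ℂ)
    (F := fun (w : ℂ) (u : ℝ) => ((u ^ 2 + 1)⁻¹ : ℝ) • ((u : ℂ) - w)⁻¹)
    (F' := fun (w : ℂ) (u : ℝ) => ((u ^ 2 + 1)⁻¹ : ℝ) • (((u : ℂ) - w)⁻¹) ^ 2)
    (x₀ := z) (s := Metric.ball z (z.im / 2))
    (bound := fun u => (u ^ 2 + 1)⁻¹ * ((z.im / 2)⁻¹) ^ 2)
    (Metric.ball_mem_nhds z hr) ?_ (F.integrable_cauchyKernel hz) ?_ ?_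
    (F.integrable.mul_const _) ?_
  · exact this.2.differentiableAt
  · filter_upwards [Metric.ball_mem_nhds z hr] with w hw
    exact (F.integrable_cauchyKernel (hr.trans_le (him w hw))).aestronglyMeasurable
  · refine (F.integrable_smul (C := ((z.im)⁻¹) ^ 2) ((continuous_ofReal_sub_inv hz).pow 2)
      fun u => ?_).aestronglyMeasurable
    rw [Pi.pow_apply, norm_pow]
    exact pow_le_pow_left₀ (norm_nonneg _) (norm_ofReal_sub_inv_le hz le_rfl u) 2
  · refine Eventually.of_forall fun u w hw => ?_
    rw [norm_smul, norm_pow, Real.norm_eq_abs, abs_of_nonneg (by positivity)]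
    exact mul_le_mul_of_nonneg_left
      (pow_le_pow_left₀ (norm_nonneg _) (norm_ofReal_sub_inv_le hr (him w hw) u) 2) (by positivity)
  · refine Eventually.of_forall fun u w hw => ?_
    have hne := ofReal_sub_ne_zero (hr.trans_le (him w hw)) u
    have h1 := ((hasDerivAt_id w).const_sub (u : ℂ)).inv hne
    refine (h1.const_smul ((u ^ 2 + 1)⁻¹ : ℝ)).congr_deriv ?_
    simp

lemma differentiableOn_eval (F : HPFunction) : DifferentiableOn ℂ F.eval openUpperHalfPlane := by
  have h : DifferentiableOn ℂ (fun z => (F.eval Complex.I).re + (F.eval Complex.I).im * z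
      + (1 + z ^ 2) * F.cauchyTransform z) openUpperHalfPlane := by
    intro z hz
    have := F.differentiableAt_cauchyTransform hz
    exact DifferentiableAt.differentiableWithinAt (by fun_prop)
  exact h.congr fun z hz => F.eval_eq hz

lemma continuous_pair : Continuous pair := continuous_induced_dom

lemma continuous_eval_I : Continuous fun F : HPFunction => F.eval Complex.I :=
  continuous_snd.comp continuous_pair

lemma continuous_weightedIntegral_of_hasCompactSupport {ψ : ℝ → ℝ} (hψ : Continuous ψ)
    (hs : HasCompactSupport ψ) : Continuous fun F : HPFunction => F.weightedIntegral ψ := by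
  have hc : Continuous (fun u : ℝ => (u ^ 2 + 1)⁻¹ * ψ u) :=
    (Continuous.inv₀ (by fun_prop) (fun u => by positivity)).mul hψ
  let f : CompactlySupportedContinuousMap ℝ ℝ := ⟨⟨_, hc⟩, hs.mul_left⟩
  exact (continuous_apply f).comp (continuous_fst.comp continuous_pair)

/-- Soft thresholding makes `ψ` compactly supported at uniform cost `ε`. The weighted mass is at
most `Im F(i)`, which is locally bounded, so the integrals are locally uniform limits of continuous
functions. -/
lemma continuous_weightedIntegral {ψ : ℝ → ℝ} (hψ : Continuous ψ)
    (h0 : Tendsto ψ (cocompact ℝ) (𝓝 0)) :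
    Continuous fun F : HPFunction => F.weightedIntegral ψ := by
  have hsupp : ∀ ε : ℝ, 0 < ε → HasCompactSupport (softThreshold ε ∘ ψ) := by
    intro ε hε
    have hev : ∀ᶠ u in cocompact ℝ, |ψ u| < ε := by
      simpa using (h0.abs.eventually_lt_const (by simpa using hε))
    obtain ⟨K, hK, hKs⟩ := mem_cocompact.1 hev
    refine HasCompactSupport.intro hK fun u hu => softThreshold_eq_zero ?_
    exact (show |ψ u| < ε from hKs hu).le
  obtain ⟨C, hC⟩ : ∃ C, ∀ u, ‖ψ u‖ ≤ C := by
    obtain ⟨C, hC⟩ := (hsupp 1 one_pos).exists_bound_of_continuous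
      ((continuous_softThreshold 1).comp hψ)
    refine ⟨C + 1, fun u => ?_⟩
    have h1 := abs_sub_softThreshold_le zero_le_one (ψ u)
    have h2 := hC u
    simp only [Function.comp, Real.norm_eq_abs] at h2
    have h3 := abs_add_le (softThreshold 1 (ψ u)) (ψ u - softThreshold 1 (ψ u))
    rw [add_sub_cancel] at h3
    rw [Real.norm_eq_abs]
    linarith
  rw [continuous_iff_continuousAt]
  intro F₀
  refine continuousAt_of_locally_uniform_approx_of_continuousAt fun U hU => ?_
  obtain ⟨δ, hδ, hδU⟩ := Metric.mem_uniformity_dist.1 hU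
  -- The added 1 makes `Im F(i) < M` hold on a neighbourhood of `F₀`; thresholding at `δ/(2M)` then
  -- costs at most `δ/2`.
  set M := (F₀.eval Complex.I).im + 1
  have hM : 0 < M := by
    have := F₀.eval_im_nonneg (z := Complex.I) (by simp)
    positivity
  have hlt : ∀ᶠ F : HPFunction in 𝓝 F₀, (F.eval Complex.I).im < M :=
    (Complex.continuous_im.comp continuous_eval_I).continuousAt.eventually_lt_const (lt_add_one _)
  set ε := δ / (2 * M)
  have hε : 0 < ε := by positivity
  refine ⟨_, hlt, _, (continuous_weightedIntegral_of_hasCompactSupport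
    ((continuous_softThreshold ε).comp hψ) (hsupp ε hε)).continuousAt, fun F hF => hδU ?_⟩
  have hF' : (F.eval Complex.I).im < M := hF
  have hbd : ∀ u, ‖ψ u - softThreshold ε (ψ u)‖ ≤ ε := fun u => abs_sub_softThreshold_le hε.le _
  have hcs := (continuous_softThreshold ε).comp hψ
  have hi1 := F.integrable_smul hψ hC
  have hi2 := F.integrable_smul (hψ.sub hcs) hbd
  have hi3 : Integrable (fun u => ((u ^ 2 + 1)⁻¹ : ℝ) • (softThreshold ε ∘ ψ) u) F.μ := by
    refine (hi1.sub hi2).congr (Eventually.of_forall fun u => ?_)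
    simp; ring
  simp only [smul_eq_mul] at hi1 hi2 hi3
  rw [dist_eq_norm, weightedIntegral, weightedIntegral, ← integral_sub hi1 hi3]
  refine lt_of_le_of_lt (norm_integral_le_of_norm_le (F.integrable.mul_const ε)
    (Eventually.of_forall fun u => ?_)) ?_
  · rw [← mul_sub, norm_mul, Real.norm_eq_abs, abs_of_nonneg (by positivity)]
    exact mul_le_mul_of_nonneg_left (hbd u) (by positivity)
  · rw [integral_mul_const]
    have h1 : (∫ u : ℝ, (u ^ 2 + 1)⁻¹ ∂F.μ) * ε ≤ M * ε :=
      mul_le_mul_of_nonneg_right (F.integral_weight_le.trans hF'.le) hε.le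
    have h2 : M * ε = δ / 2 := by simp only [ε]; field_simp
    linarith

lemma continuous_cauchyTransform {z : ℂ} (hz : 0 < z.im) :
    Continuous fun F : HPFunction => F.cauchyTransform z := by
  have hre : ∀ F : HPFunction, F.weightedIntegral (fun u => (((u : ℂ) - z)⁻¹).re)
      = (F.cauchyTransform z).re := by
    intro F
    have := integral_re (F.integrable_cauchyKernel hz)
    simp only [RCLike.re_to_complex] at this
    rw [cauchyTransform, ← this, weightedIntegral]
    simp only [Complex.real_smul, Complex.re_ofReal_mul]
  have him : ∀ F : HPFunction, F.weightedIntegral (fun u => (((u : ℂ) - z)⁻¹).im)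
      = (F.cauchyTransform z).im := by
    intro F
    have := integral_im (F.integrable_cauchyKernel hz)
    simp only [RCLike.im_to_complex] at this
    rw [cauchyTransform, ← this, weightedIntegral]
    simp only [Complex.real_smul, Complex.im_ofReal_mul]
  have h1 : Continuous fun F : HPFunction => (F.cauchyTransform z).re := by
    simp_rw [← hre]
    refine continuous_weightedIntegral
      (Complex.continuous_re.comp (continuous_ofReal_sub_inv hz)) ?_
    simpa only [Complex.zero_re, Function.comp_def] using
      (Complex.continuous_re.tendsto 0).comp (tendsto_ofReal_sub_inv z)
  have h2 : Continuous fun F : HPFunction => (F.cauchyTransform z).im := by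
    simp_rw [← him]
    refine continuous_weightedIntegral
      (Complex.continuous_im.comp (continuous_ofReal_sub_inv hz)) ?_
    simpa only [Complex.zero_im, Function.comp_def] using
      (Complex.continuous_im.tendsto 0).comp (tendsto_ofReal_sub_inv z)
  have h3 : Continuous fun F : HPFunction =>
      ((F.cauchyTransform z).re : ℂ) + (F.cauchyTransform z).im * Complex.I := by fun_prop
  simpa only [Complex.re_add_im] using h3

lemma continuous_eval {z : ℂ} (hz : 0 < z.im) : Continuous fun F : HPFunction => F.eval z := by
  simp_rw [eval_eq _ hz]
  have h1 := continuous_cauchyTransform hz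
  have h2 := continuous_eval_I
  have h3 := Complex.continuous_re.comp h2
  have h4 := Complex.continuous_im.comp h2
  simp only [Function.comp_def] at h3 h4
  fun_prop

/-! ### The coordinate `1/(w + i)` and boundary values on the sphere -/

/-- The bounded holomorphic function `1 / (F + i)`. -/
noncomputable def starFun (F : HPFunction) (z : ℂ) : ℂ := (F.eval z + Complex.I)⁻¹

lemma one_le_norm_eval_add_I (F : HPFunction) {z : ℂ} (hz : 0 < z.im) :
    1 ≤ ‖F.eval z + Complex.I‖ := by
  refine le_trans ?_ ((le_abs_self _).trans (Complex.abs_im_le_norm _))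
  simpa using F.eval_im_nonneg hz

lemma eval_add_I_ne_zero (F : HPFunction) {z : ℂ} (hz : 0 < z.im) : F.eval z + Complex.I ≠ 0 :=
  norm_pos_iff.1 (one_pos.trans_le (F.one_le_norm_eval_add_I hz))

lemma norm_starFun_le (F : HPFunction) (z : ℂ) (hz : 0 < z.im) : ‖F.starFun z‖ ≤ 1 := by
  rw [starFun, norm_inv]
  exact inv_le_one_of_one_le₀ (F.one_le_norm_eval_add_I hz)

lemma differentiableOn_starFun (F : HPFunction) :
    DifferentiableOn ℂ F.starFun openUpperHalfPlane :=
  (F.differentiableOn_eval.add_const _).inv fun _ hz => F.eval_add_I_ne_zero hz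

lemma continuous_starFun {z : ℂ} (hz : 0 < z.im) :
    Continuous fun F : HPFunction => F.starFun z :=
  ((continuous_eval hz).add continuous_const).inv₀ fun F => F.eval_add_I_ne_zero hz

end HPFunction

open Classical in
/-- The continuous map `w ↦ 1 / w - i` into the Riemann sphere, with `0 ↦ ∞`. -/
noncomputable def starCoordInv (w : ℂ) : OnePoint ℂ :=
  if w = 0 then OnePoint.infty else ((w⁻¹ - Complex.I : ℂ) : OnePoint ℂ)

lemma starCoordInv_zero : starCoordInv 0 = OnePoint.infty := if_pos rfl

lemma starCoordInv_of_ne {w : ℂ} (hw : w ≠ 0) :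
    starCoordInv w = ((w⁻¹ - Complex.I : ℂ) : OnePoint ℂ) := if_neg hw

lemma continuous_starCoordInv : Continuous starCoordInv := by
  rw [continuous_iff_continuousAt]
  intro w
  rcases eq_or_ne w 0 with rfl | hw
  · rw [continuousAt_iff_punctured_nhds, starCoordInv_zero]
    have h1 : Tendsto (fun w : ℂ => w⁻¹ - Complex.I) (𝓝[≠] 0) (coclosedCompact ℂ) := by
      rw [coclosedCompact_eq_cocompact, ← Metric.cobounded_eq_cocompact]
      exact (tendsto_sub_const_cobounded _).comp Filter.tendsto_inv₀_nhdsNE_zero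
    refine (OnePoint.tendsto_coe_infty.comp h1).congr' ?_
    filter_upwards [self_mem_nhdsWithin] with w hw
    exact (starCoordInv_of_ne hw).symm
  · have h1 : ContinuousAt (fun w : ℂ => ((w⁻¹ - Complex.I : ℂ) : OnePoint ℂ)) w :=
      OnePoint.continuous_coe.continuousAt.comp
        ((continuousAt_inv₀ hw).sub continuousAt_const)
    refine h1.congr ?_
    filter_upwards [isOpen_ne.mem_nhds hw] with v hv
    exact (starCoordInv_of_ne hv).symm

lemma starCoord_starCoordInv (w : ℂ) : starCoord (starCoordInv w) = w := by
  rcases eq_or_ne w 0 with rfl | hw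
  · rw [starCoordInv_zero]; rfl
  · rw [starCoordInv_of_ne hw]
    change 1 / (w⁻¹ - Complex.I + Complex.I) = w
    simp

/-- The pole `-i` is harmless, since boundary values of HP functions that exist as limits are `∞` or
have nonnegative imaginary part. -/
lemma continuousAt_starCoord {w : OnePoint ℂ} (hw : w ≠ ((-Complex.I : ℂ) : OnePoint ℂ)) :
    ContinuousAt starCoord w := by
  induction w using OnePoint.rec with
  | infty =>
    rw [OnePoint.continuousAt_infty']
    change Tendsto (fun z : ℂ => 1 / (z + Complex.I)) (coclosedCompact ℂ) (𝓝 0)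
    rw [coclosedCompact_eq_cocompact, ← Metric.cobounded_eq_cocompact]
    simp only [one_div]
    exact Filter.tendsto_inv₀_cobounded.comp (tendsto_add_const_cobounded _)
  | coe z =>
    rw [OnePoint.continuousAt_coe]
    have hz : z + Complex.I ≠ 0 := fun h => hw (by rw [eq_neg_of_add_eq_zero_left h])
    change ContinuousAt (fun z : ℂ => 1 / (z + Complex.I)) z
    fun_prop (disch := assumption)

namespace HPFunction

lemma starCoordInv_starFun (F : HPFunction) {z : ℂ} (hz : 0 < z.im) :
    starCoordInv (F.starFun z) = (F.eval z : OnePoint ℂ) := by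
  rw [starFun, starCoordInv_of_ne (inv_ne_zero (F.eval_add_I_ne_zero hz)), inv_inv,
    add_sub_cancel_right]

lemma starCoord_eval (F : HPFunction) (z : ℂ) :
    starCoord (F.eval z : OnePoint ℂ) = F.starFun z := one_div _

lemma HasBoundaryValue.ne_neg_I {F : HPFunction} {x : ℝ} {w : OnePoint ℂ}
    (h : F.HasBoundaryValue x w) : w ≠ ((-Complex.I : ℂ) : OnePoint ℂ) := by
  rintro rfl
  have h1 : Tendsto (fun η : ℝ => F.eval (x + η * Complex.I)) (𝓝[>] 0) (𝓝 (-Complex.I)) :=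
    OnePoint.isOpenEmbedding_coe.tendsto_nhds_iff.2 h
  have h2 := (Complex.continuous_im.tendsto _).comp h1
  have h3 : (0 : ℝ) ≤ (-Complex.I).im := by
    refine ge_of_tendsto h2 ?_
    filter_upwards [self_mem_nhdsWithin] with η hη
    exact F.eval_im_nonneg (by simpa using hη)
  norm_num at h3

lemma HasBoundaryValue.tendsto_starFun {F : HPFunction} {x : ℝ} {w : OnePoint ℂ}
    (h : F.HasBoundaryValue x w) :
    Tendsto (fun η : ℝ => F.starFun (x + η * Complex.I)) (𝓝[>] 0) (𝓝 (starCoord w)) := by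
  simp_rw [← starCoord_eval]
  exact (continuousAt_starCoord h.ne_neg_I).tendsto.comp h

lemma hasBoundaryValue_of_tendsto {F : HPFunction} {x : ℝ} {c : ℂ}
    (h : Tendsto (fun η : ℝ => F.starFun (x + η * Complex.I)) (𝓝[>] 0) (𝓝 c)) :
    F.HasBoundaryValue x (starCoordInv c) := by
  refine ((continuous_starCoordInv.tendsto c).comp h).congr' ?_
  filter_upwards [self_mem_nhdsWithin] with η hη
  exact F.starCoordInv_starFun (by simpa using hη)

/-- The two conventions agree: where no limit exists, `verticalLimit` is 0, which corresponds to
`∞`. Hence the identity holds at every `x`, not just almost everywhere. -/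
lemma boundaryValue_eq (F : HPFunction) (x : ℝ) :
    F.boundaryValue x = starCoordInv (verticalLimit F.starFun x) := by
  by_cases h : ∃ c, Tendsto (fun η : ℝ => F.starFun (x + η * Complex.I)) (𝓝[>] 0) (𝓝 c)
  · obtain ⟨c, hc⟩ := h
    have h1 := hasBoundaryValue_of_tendsto hc
    have h2 : ∃ w, F.HasBoundaryValue x w := ⟨_, h1⟩
    rw [verticalLimit, rightLimit_eq hc, boundaryValue, dif_pos h2]
    exact tendsto_nhds_unique h2.choose_spec h1
  · have h2 : ¬ ∃ w, F.HasBoundaryValue x w := fun ⟨w, hw⟩ => h ⟨_, hw.tendsto_starFun⟩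
    rw [verticalLimit, rightLimit_of_not_exists h, boundaryValue, dif_neg h2, starCoordInv_zero]

lemma starCoord_boundaryValue (F : HPFunction) (x : ℝ) :
    starCoord (F.boundaryValue x) = verticalLimit F.starFun x := by
  rw [boundaryValue_eq, starCoord_starCoordInv]

end HPFunction

/-! ### The mean distance between boundary values and values at height `η` -/

namespace HPFunction

/-- Joint measurability is what Tonelli requires later. At each height it follows from continuity in
the point and measurability in `F`. -/
lemma measurable_verticalLimit_uncurry :
    Measurable (fun p : ℝ × HPFunction => verticalLimit p.2.starFun p.1) := by
  refine (stronglyMeasurable_rightLimit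
    (Φ := fun (η : ℝ) (p : ℝ × HPFunction) => p.2.starFun (p.1 + η * Complex.I))
    (fun η hη => ?_) (fun p => continuousOn_vertical p.2.differentiableOn_starFun p.1)).measurable
  refine (measurable_uncurry_of_continuous_of_measurable
    (u := fun (x : ℝ) (F : HPFunction) => F.starFun (x + η * Complex.I)) (fun F => ?_)
    (fun x => ?_)).stronglyMeasurable
  · exact continuous_horizontal F.differentiableOn_starFun hη
  · exact (continuous_starFun (by simpa using hη)).measurable

lemma measurable_verticalLimit (x : ℝ) :
    Measurable (fun F : HPFunction => verticalLimit F.starFun x) := by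
  have h : Measurable (fun F : HPFunction => ((x, F) : ℝ × HPFunction)) := measurable_prodMk_left
  simpa only [Function.comp_def] using measurable_verticalLimit_uncurry.comp h

lemma starModulus_eq (P : ProbabilityMeasure HPFunction) (x δ : ℝ) :
    starModulus P x δ = ∫⁻ F, ‖verticalLimit F.starFun (x + δ) - verticalLimit F.starFun x‖ₑ
      ∂(P : Measure HPFunction) := by
  simp only [starModulus, starCoord_boundaryValue]

lemma starModulus_le_two (P : ProbabilityMeasure HPFunction) (x δ : ℝ) :
    starModulus P x δ ≤ 2 := by
  rw [starModulus_eq]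
  refine (lintegral_mono (g := fun _ => (2 : ℝ≥0∞)) fun F => ?_).trans (by simp)
  have h : ‖verticalLimit F.starFun (x + δ) - verticalLimit F.starFun x‖ ≤ 2 := by
    refine (norm_sub_le _ _).trans ?_
    linarith [norm_verticalLimit_le F.norm_starFun_le (x + δ),
      norm_verticalLimit_le F.norm_starFun_le x]
  rw [← ofReal_norm]
  exact (ENNReal.ofReal_le_ofReal h).trans (by simp)

/-- The Poisson formula bounds the increment for each `F` by a Cauchy average; exchanging the two
integrals produces the modulus. -/
lemma lintegral_starFun_sub_le (P : ProbabilityMeasure HPFunction) (x : ℝ) {η : ℝ} (hη : 0 < η) :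
    ∫⁻ F, ‖F.starFun (x + η * Complex.I) - verticalLimit F.starFun x‖ₑ ∂(P : Measure HPFunction)
      ≤ ∫⁻ u, starModulus P x (η * u) ∂stdCauchy := by
  simp_rw [starModulus_eq]
  rw [lintegral_lintegral_swap]
  · exact lintegral_mono fun F => enorm_sub_verticalLimit_le F.differentiableOn_starFun
      F.norm_starFun_le x hη _
  · refine Measurable.aemeasurable ?_
    refine Measurable.enorm (Measurable.sub ?_ ?_)
    · have h : Measurable (fun p : ℝ × HPFunction => (x + η * p.1, p.2)) := by fun_prop
      simpa only [Function.comp_def] using measurable_verticalLimit_uncurry.comp h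
    · exact (measurable_verticalLimit x).comp measurable_snd

end HPFunction

lemma exists_stdCauchy_tail_le {r : ℝ} (hr : 0 < r) {ε : ℝ≥0∞} (hε : ε ≠ 0) :
    ∃ η : ℝ, 0 < η ∧ stdCauchy {u | r ≤ |η * u|} ≤ ε := by
  have hlim := tendsto_measure_iInter_atTop (μ := stdCauchy) (s := fun n : ℕ => {u : ℝ | n ≤ |u|})
    (fun n => (measurableSet_le measurable_const (by fun_prop)).nullMeasurableSet)
    (fun m n hmn u (hu : (n : ℝ) ≤ |u|) => (Nat.cast_le.2 hmn).trans hu) ⟨0, measure_ne_top _ _⟩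
  have hempty : ⋂ n : ℕ, {u : ℝ | n ≤ |u|} = ∅ := by
    ext u
    obtain ⟨n, hn⟩ := exists_nat_gt |u|
    simp only [Set.mem_iInter, Set.mem_ofPred_eq, Set.mem_empty_iff_false, iff_false, not_forall]
    exact ⟨n, not_le.2 hn⟩
  rw [hempty, measure_empty] at hlim
  obtain ⟨n, hn, hn0⟩ := ((hlim.eventually_le_const (pos_iff_ne_zero.2 hε)).and
    (eventually_gt_atTop 0)).exists
  have hn' : (0 : ℝ) < n := by exact_mod_cast hn0
  refine ⟨r / n, by positivity, (measure_mono fun u hu => ?_).trans hn⟩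
  have hu' : r ≤ |r / n * u| := hu
  rw [abs_mul, abs_of_pos (by positivity), div_mul_eq_mul_div, le_div_iff₀ hn'] at hu'
  exact le_of_mul_le_mul_left hu' hr

/-! ### Uniform approximation and convergence in distribution -/

namespace HPFunction

/-- Under a common modulus of `*`-continuity, the boundary values are uniformly approximated in
mean by the values at some height. -/
lemma exists_height {κ : ℝ → ℝ≥0∞} (hκ : Tendsto κ (𝓝[≠] 0) (𝓝 0)) (x : ℝ) {ε : ℝ≥0∞}
    (hε : ε ≠ 0) :
    ∃ η : ℝ, 0 < η ∧ ∀ P : ProbabilityMeasure HPFunction, (∀ᵐ δ, starModulus P x δ ≤ κ δ) →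
      ∫⁻ F, ‖F.starFun (x + η * Complex.I) - verticalLimit F.starFun x‖ₑ
        ∂(P : Measure HPFunction) ≤ ε := by
  have hε2 : ε / 2 ≠ 0 := by simpa using hε
  have hε4 : ε / 2 / 2 ≠ 0 := by simpa using hε
  obtain ⟨r, hr, hrκ⟩ := Metric.mem_nhdsWithin_iff.1
    (hκ.eventually_le_const (pos_iff_ne_zero.2 hε2))
  obtain ⟨η, hη, htail⟩ := exists_stdCauchy_tail_le hr hε4
  refine ⟨η, hη, fun P hP => (lintegral_starFun_sub_le P x hη).trans ?_⟩
  -- The limit of `κ` is punctured and says nothing about `κ 0`, so the null set `δ = 0` is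
  -- discarded.
  have hne : ∀ᵐ δ : ℝ, δ ≠ 0 := by simp [ae_iff]
  have hae : ∀ᵐ u ∂stdCauchy, starModulus P x (η * u) ≤
      ε / 2 + Set.indicator {u : ℝ | r ≤ |η * u|} (fun _ => 2) u := by
    filter_upwards [(quasiMeasurePreserving_const_mul hη).ae (hP.and hne)] with u ⟨hu, hu0⟩
    by_cases hur : r ≤ |η * u|
    · rw [Set.indicator_of_mem (by exact hur)]
      exact (starModulus_le_two P x _).trans le_add_self
    · have hmem : κ (η * u) ≤ ε / 2 := hrκ ⟨by simpa using lt_of_not_ge hur, hu0⟩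
      exact (hu.trans hmem).trans le_self_add
  refine (lintegral_mono_ae hae).trans ?_
  rw [lintegral_add_left measurable_const, lintegral_indicator_const
    (measurableSet_le measurable_const (by fun_prop))]
  simp only [lintegral_const, measure_univ, mul_one]
  calc ε / 2 + 2 * stdCauchy {u | r ≤ |η * u|} ≤ ε / 2 + 2 * (ε / 2 / 2) := by gcongr
    _ = ε := by
      rw [ENNReal.mul_div_cancel (by simp) (by simp), ENNReal.add_halves]

lemma dist_integral_le {P : ProbabilityMeasure HPFunction} {x η ε : ℝ} (hη : 0 < η) (hε : 0 ≤ ε)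
    (h : ∫⁻ F, ‖F.starFun (x + η * Complex.I) - verticalLimit F.starFun x‖ₑ
        ∂(P : Measure HPFunction) ≤ ENNReal.ofReal ε)
    {φ : ℂ → ℝ} {C : ℝ} (hC : ∀ w, ‖φ w‖ ≤ C) {L : NNReal} (hL : LipschitzWith L φ) :
    dist (∫ F, φ (F.starFun (x + η * Complex.I)) ∂(P : Measure HPFunction))
      (∫ F, φ (verticalLimit F.starFun x) ∂(P : Measure HPFunction)) ≤ L * ε := by
  have hm1 : Measurable fun F : HPFunction => F.starFun (x + η * Complex.I) :=
    (continuous_starFun (by simpa using hη)).measurable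
  have hm2 := measurable_verticalLimit x
  have hb : ∀ F : HPFunction,
      ‖F.starFun (x + η * Complex.I) - verticalLimit F.starFun x‖ ≤ 2 := by
    intro F
    refine (norm_sub_le _ _).trans ?_
    linarith [norm_verticalLimit_le F.norm_starFun_le x,
      F.norm_starFun_le (x + η * Complex.I) (by simpa using hη)]
  have hint : ∀ {f : HPFunction → ℂ}, Measurable f →
      Integrable (fun F => φ (f F)) (P : Measure HPFunction) := fun hf =>
    Integrable.of_bound (hL.continuous.measurable.comp hf).aestronglyMeasurable C
      (Eventually.of_forall fun F => hC _)
  have hi : Integrable (fun F : HPFunction =>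
      F.starFun (x + η * Complex.I) - verticalLimit F.starFun x) (P : Measure HPFunction) :=
    Integrable.of_bound (hm1.sub hm2).aestronglyMeasurable 2 (Eventually.of_forall hb)
  rw [dist_eq_norm, ← integral_sub (hint hm1) (hint hm2)]
  refine (norm_integral_le_of_norm_le (hi.norm.const_mul (L : ℝ))
    (Eventually.of_forall fun F => ?_)).trans ?_
  · simpa only [dist_eq_norm] using hL.dist_le_mul _ _
  · rw [integral_const_mul, integral_norm_eq_lintegral_enorm hi.aestronglyMeasurable]
    exact mul_le_mul_of_nonneg_left (ENNReal.toReal_le_of_le_ofReal hε h) L.2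

lemma tendsto_integral_starFun {P : ℕ → ProbabilityMeasure HPFunction}
    {Q : ProbabilityMeasure HPFunction} (hconv : Tendsto P atTop (𝓝 Q)) {z : ℂ} (hz : 0 < z.im)
    {φ : ℂ → ℝ} {C : ℝ} (hC : ∀ v w, dist (φ v) (φ w) ≤ C) (hφ : Continuous φ) :
    Tendsto (fun n => ∫ F, φ (F.starFun z) ∂(P n : Measure HPFunction)) atTop
      (𝓝 (∫ F, φ (F.starFun z) ∂(Q : Measure HPFunction))) :=
  ProbabilityMeasure.tendsto_iff_forall_integral_tendsto.1 hconv
    ⟨⟨fun F => φ (F.starFun z), hφ.comp (continuous_starFun hz)⟩, C, fun _ _ => hC _ _⟩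

theorem tendstoInDistribution_verticalLimit {P : ℕ → ProbabilityMeasure HPFunction}
    {Q : ProbabilityMeasure HPFunction} (hconv : Tendsto P atTop (𝓝 Q)) {κ : ℝ → ℝ≥0∞} {x : ℝ}
    (hP : ∀ n, ∀ᵐ δ : ℝ, starModulus (P n) x δ ≤ κ δ)
    (hQ : ∀ᵐ δ : ℝ, starModulus Q x δ ≤ κ δ) (hκ : Tendsto κ (𝓝[≠] 0) (𝓝 0)) :
    TendstoInDistribution (fun (_ : ℕ) (F : HPFunction) => verticalLimit F.starFun x) atTop
      (fun F : HPFunction => verticalLimit F.starFun x)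
      (fun n => (P n : Measure HPFunction)) (Q : Measure HPFunction) := by
  have hm := measurable_verticalLimit x
  refine ⟨fun _ => hm.aemeasurable, hm.aemeasurable, ?_⟩
  refine tendsto_iff_forall_lipschitz_integral_tendsto.2 ?_
  rintro φ ⟨C, hC⟩ ⟨L, hL⟩
  have hmap : ∀ ρ : Measure HPFunction,
      ∫ w, φ w ∂(ρ.map fun F : HPFunction => verticalLimit F.starFun x)
        = ∫ F : HPFunction, φ (verticalLimit F.starFun x) ∂ρ := fun ρ =>
    integral_map hm.aemeasurable hL.continuous.aestronglyMeasurable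
  simp only [ProbabilityMeasure.coe_mk, hmap]
  have hbound : ∀ w, ‖φ w‖ ≤ C + ‖φ 0‖ := by
    intro w
    have := hC w 0
    rw [dist_eq_norm] at this
    linarith [norm_le_norm_add_norm_sub' (φ w) (φ 0)]
  rw [Metric.tendsto_atTop]
  intro ε hε
  -- The `+ 1` avoids division by zero when `L = 0` and makes `L * ε'` strictly less than `ε / 3`.
  set ε' : ℝ := ε / (3 * (L + 1))
  have hL0 : (0 : ℝ) ≤ L := L.2
  have hε' : 0 < ε' := by positivity
  have hLε : L * ε' < ε / 3 := by
    have h1 : (L + 1) * ε' = ε / 3 := by simp only [ε']; field_simp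
    nlinarith
  obtain ⟨η, hη, hηP⟩ := exists_height hκ x (ENNReal.ofReal_pos.2 hε').ne'
  obtain ⟨N, hN⟩ := Metric.tendsto_atTop.1 (tendsto_integral_starFun hconv
    (z := x + η * Complex.I) (by simpa using hη) hC hL.continuous) (ε / 3) (by positivity)
  refine ⟨N, fun n hn => ?_⟩
  have h1 := dist_integral_le hη hε'.le (hηP (P n) (hP n)) hbound hL
  have h2 := dist_integral_le hη hε'.le (hηP Q hQ) hbound hL
  rw [dist_comm] at h1
  refine (dist_triangle4 _ (∫ F, φ (F.starFun (x + η * Complex.I)) ∂(P n : Measure HPFunction))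
    (∫ F, φ (F.starFun (x + η * Complex.I)) ∂(Q : Measure HPFunction)) _).trans_lt ?_
  linarith [hN n hn]

end HPFunction

theorem mainTheorem10
    (P : ℕ → ProbabilityMeasure HPFunction) (Q : ProbabilityMeasure HPFunction)
    (hconv : Tendsto P atTop (𝓝 Q))
    (κ : ℝ → ℝ → ℝ≥0∞) (x : ℝ)
    (hP : ∀ n, ∀ᵐ δ : ℝ, starModulus (P n) x δ ≤ κ x δ)
    (hQ : ∀ᵐ δ : ℝ, starModulus Q x δ ≤ κ x δ)
    (hκ : Tendsto (fun δ => κ x δ) (𝓝[≠] 0) (𝓝 0)) :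
    TendstoInDistribution
      (fun (_ : ℕ) (F : HPFunction) => F.boundaryValue x) atTop
      (fun F : HPFunction => F.boundaryValue x)
      (fun n => (P n : Measure HPFunction)) (Q : Measure HPFunction) := by
  have h := (HPFunction.tendstoInDistribution_verticalLimit hconv hP hQ hκ).continuous_comp
    continuous_starCoordInv
  simp only [HPFunction.boundaryValue_eq]
  exact h
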